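/- All rings are integral domains. For a domain $A$ with quotient field $F$, let $\mathcal S(A)$ be its class semigroup: the multiplicative semigroup of nonzero fractional ideals of $A$ modulo nonzero principal fractional ideals (so $I\sim J$ iff $J=xI$ for some $0\neq x\in F$). $A$ is *Clifford regular* if every element $s$ of $\mathcal S(A)$ is von Neumann regular, i.e. $s^2a=s$ for some $a\in\mathcal S(A)$. $A$ is *conducive* if for every ring $B$ with $A\subseteq B\subsetneq F$ the conductor $(A:B)=\{x\in F: xB\subseteq A\}$ is nonzero. $A$ is *semilocal* if it has only finitely many maximal ideals. **Theorem 5.5.** Let $K$ be a field and let $D\subsetneq K$ be a proper subring with quotient field $K$; suppose that $D$ is semilocal and conducive. (a) Let $T$ be a valuation domain with maximal ideal $M$ and residue field $T/M= K$, let $\phi:T\to K$ be the canonical surjection, and let $R:=\phi^{-1}(D)$. Then $R$ is Clifford regular if and only if $D$ is Clifford regular. (b) Let $X$ be an indeterminate over $K$ and let $R:=D+XK[X]\subseteq K[X]$. Then $R$ is Clifford regular if and only if $D$ is Clifford regular. -/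

import Mathlib

open scoped nonZeroDivisors Polynomial

noncomputable section

/-- A commutative semigroup is a Clifford semigroup if every element `x` is von Neumann regular,
i.e. `x ^ 2 * a = x` for some `a`. -/
def IsCliffordSemigroup (S : Type*) [CommSemigroup S] : Prop :=
  ∀ x : S, ∃ a : S, x * x * a = x

/-- The monoid of nonzero fractional ideals of a domain `R` (inside its quotient field). -/
def nonzeroFractionalIdeals (R : Type*) [CommRing R] [IsDomain R] :
    Submonoid (FractionalIdeal R⁰ (FractionRing R)) where
  carrier := {I | I ≠ 0}
  one_mem' := one_ne_zero
  mul_mem' := by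
    intro I J hI hJ h
    change I ≠ 0 at hI
    change J ≠ 0 at hJ
    obtain ⟨x, hx, hx0⟩ : ∃ x ∈ I, x ≠ 0 := by
      by_contra! hc
      exact hI (FractionalIdeal.eq_zero_iff.mpr hc)
    obtain ⟨y, hy, hy0⟩ : ∃ y ∈ J, y ≠ 0 := by
      by_contra! hc
      exact hJ (FractionalIdeal.eq_zero_iff.mpr hc)
    have hxy : x * y ∈ I * J := FractionalIdeal.mul_mem_mul hx hy
    rw [h] at hxy
    exact mul_ne_zero hx0 hy0 (FractionalIdeal.eq_zero_iff.mp rfl _ hxy)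

/-- Two nonzero fractional ideals are identified when they differ by a nonzero principal
fractional ideal: `J = x I` with `x ≠ 0` in the quotient field. -/
def principalCon (R : Type*) [CommRing R] [IsDomain R] : Con (nonzeroFractionalIdeals R) where
  r I J := ∃ x : FractionRing R, x ≠ 0 ∧
    (J : FractionalIdeal R⁰ (FractionRing R)) =
      FractionalIdeal.spanSingleton R⁰ x * (I : FractionalIdeal R⁰ (FractionRing R))
  iseqv :=
    { refl := fun I => ⟨1, one_ne_zero, by simp⟩
      symm := by
        rintro I J ⟨x, hx, h⟩
        refine ⟨x⁻¹, inv_ne_zero hx, ?_⟩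
        rw [h, ← mul_assoc, FractionalIdeal.spanSingleton_mul_spanSingleton,
          inv_mul_cancel₀ hx, FractionalIdeal.spanSingleton_one, one_mul]
      trans := by
        rintro I J L ⟨x, hx, h⟩ ⟨y, hy, h'⟩
        refine ⟨y * x, mul_ne_zero hy hx, ?_⟩
        rw [h', h, ← mul_assoc, FractionalIdeal.spanSingleton_mul_spanSingleton] }
  mul' := by
    rintro I J I' J' ⟨x, hx, h⟩ ⟨y, hy, h'⟩
    refine ⟨x * y, mul_ne_zero hx hy, ?_⟩
    rw [Submonoid.coe_mul, Submonoid.coe_mul, h, h',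
      ← FractionalIdeal.spanSingleton_mul_spanSingleton, mul_mul_mul_comm]

/-- The class semigroup of a domain `R`: nonzero fractional ideals modulo nonzero principal
ones, with the operation induced by multiplication of ideals. -/
abbrev ClassSemigroup (R : Type*) [CommRing R] [IsDomain R] : Type _ :=
  (principalCon R).Quotient

/-- A domain is Clifford regular if its class semigroup is a Clifford semigroup. -/
def IsCliffordRegular (R : Type*) [CommRing R] [IsDomain R] : Prop :=
  IsCliffordSemigroup (ClassSemigroup R)

/-- A domain `A` is conducive if the conductor `(A : B) = {x | x B ⊆ A}` is nonzero for every
overring `B` of `A` (a ring between `A` and its quotient field) other than the quotient field. -/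
def IsConducive (A : Type*) [CommRing A] [IsDomain A] : Prop :=
  ∀ B : Subalgebra A (FractionRing A), B ≠ ⊤ →
    (1 : Submodule A (FractionRing A)) / Subalgebra.toSubmodule B ≠ ⊥

/-- A ring is semilocal if it has only finitely many maximal ideals. -/
def HasFinitelyManyMaximalIdeals (A : Type*) [CommRing A] : Prop :=
  {m : Ideal A | m.IsMaximal}.Finite

/-- The subring `D + X K[X]` of `K[X]`. -/
def dPlusXK {K : Type*} [Field K] (D : Subring K) : Subring K[X] where
  carrier := {f | ∃ d ∈ D, ∃ g : K[X], f = Polynomial.C d + Polynomial.X * g}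
  one_mem' := ⟨1, D.one_mem, 0, by simp⟩
  zero_mem' := ⟨0, D.zero_mem, 0, by simp⟩
  mul_mem' := by
    rintro _ _ ⟨d, hd, g, rfl⟩ ⟨e, he, h, rfl⟩
    exact ⟨d * e, D.mul_mem hd he,
      Polynomial.C d * h + Polynomial.C e * g + Polynomial.X * g * h, by
        rw [Polynomial.C_mul]; ring⟩
  add_mem' := by
    rintro _ _ ⟨d, hd, g, rfl⟩ ⟨e, he, h, rfl⟩
    exact ⟨d + e, D.add_mem hd he, g + h, by rw [Polynomial.C_add]; ring⟩
  neg_mem' := by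
    rintro _ ⟨d, hd, g, rfl⟩
    exact ⟨-d, D.neg_mem hd, -g, by rw [Polynomial.C_neg]; ring⟩

/-- `D + X K[X]` is the pullback of `D` along `K[X] → K`, `f ↦ f(0)`. -/
theorem dPlusXK_eq_comap {K : Type*} [Field K] (D : Subring K) :
    dPlusXK D = D.comap (Polynomial.constantCoeff : K[X] →+* K) := by
  ext f
  constructor
  · rintro ⟨d, hd, g, rfl⟩
    simpa [Subring.mem_comap] using hd
  · intro hf
    refine ⟨f.coeff 0, hf, f.divX, ?_⟩
    rw [add_comm, mul_comm]
    exact (Polynomial.divX_mul_X_add f).symm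

end

open scoped nonZeroDivisors Polynomial

noncomputable section

/-! Both rings are pullbacks of `D` along a surjection `φ : T → K` for which every nonzero element
of `K` lifts to a unit of `T`. The submodules between `ker φ` and `T` correspond to the
`D`-submodules of `K`, and on nonzero ones this correspondence is multiplicative
(`pullbackSubmodule_mul`). Regularity therefore descends to `D` by pulling fractional ideals back.

For the converse, a nonzero fractional ideal of the pullback is scaled to lie between `ker φ` and
`T` with nonzero image in `K`. That image is either `K`, which is idempotent, or fractional because
`D` is conducive. Scaling always succeeds when `T` is a PID; when `T` is a valuation ring, the only
exceptions are `T`-modules, which are regular for valuation-theoretic reasons. -/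

/-- A submodule of an algebra is von Neumann regular if it is a regular element of the
multiplicative semigroup of submodules. -/
def Submodule.IsVonNeumannRegular {A L : Type*} [CommRing A] [CommRing L] [Algebra A L]
    (N : Submodule A L) : Prop :=
  ∃ J : Submodule A L, N * N * J = N

/-! ### Scaling and regularity of submodules of a field -/

section Field

variable {A L : Type*} [CommRing A] [Field L] [Algebra A L]

theorem Submodule.mul_ne_bot_of_field {N P : Submodule A L} (hN : N ≠ ⊥) (hP : P ≠ ⊥) :
    N * P ≠ ⊥ := by
  obtain ⟨n, hn, hn0⟩ := N.ne_bot_iff.1 hN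
  obtain ⟨p, hp, hp0⟩ := P.ne_bot_iff.1 hP
  exact (Submodule.ne_bot_iff _).2 ⟨n * p, Submodule.mul_mem_mul hn hp, mul_ne_zero hn0 hp0⟩

theorem Submodule.IsVonNeumannRegular.of_span_singleton_mul {N : Submodule A L} {x : L}
    (hx : x ≠ 0) (h : (Submodule.span A {x} * N).IsVonNeumannRegular) :
    N.IsVonNeumannRegular := by
  obtain ⟨J, hJ⟩ := h
  have hinv : Submodule.span A {x⁻¹} * Submodule.span A {x} = 1 := by
    rw [Submodule.span_mul_span, Set.singleton_mul_singleton, inv_mul_cancel₀ hx,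
      Submodule.one_eq_span]
  refine ⟨Submodule.span A {x} * J, ?_⟩
  calc N * N * (Submodule.span A {x} * J)
      = (Submodule.span A {x⁻¹} * Submodule.span A {x}) *
          (N * N * (Submodule.span A {x} * J)) := by rw [hinv, one_mul]
    _ = Submodule.span A {x⁻¹} *
          (Submodule.span A {x} * N * (Submodule.span A {x} * N) * J) := by ring
    _ = N := by rw [hJ, ← mul_assoc, hinv, one_mul]

end Field

/-! ### Clifford regularity in terms of submodules -/

section FractionField

variable {A L : Type*} [CommRing A] [IsDomain A] [Field L] [Algebra A L] [IsFractionRing A L]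

theorem isFractional_iff_exists_mul_mem_one {N : Submodule A L} :
    IsFractional A⁰ N ↔ ∃ c : L, c ≠ 0 ∧ ∀ n ∈ N, c * n ∈ (1 : Submodule A L) := by
  constructor
  · rintro ⟨a, ha, h⟩
    refine ⟨algebraMap A L a, IsFractionRing.to_map_ne_zero_of_mem_nonZeroDivisors ha, ?_⟩
    intro n hn
    obtain ⟨b, hb⟩ := h n hn
    exact Submodule.mem_one.2 ⟨b, by rw [hb, Algebra.smul_def]⟩
  · rintro ⟨c, hc, h⟩
    obtain ⟨a, b, hb, rfl⟩ := IsFractionRing.div_surjective (A := A) c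
    have hb0 : algebraMap A L b ≠ 0 := IsFractionRing.to_map_ne_zero_of_mem_nonZeroDivisors hb
    have ha : a ≠ 0 := by rintro rfl; simp at hc
    refine ⟨a, mem_nonZeroDivisors_of_ne_zero ha, fun n hn => ?_⟩
    obtain ⟨d, hd⟩ := Submodule.mem_one.1 (h n hn)
    refine ⟨b * d, ?_⟩
    rw [map_mul, hd, Algebra.smul_def]
    field_simp

/-- Makes any submodule `J` witnessing regularity automatically fractional, so regularity may be
tested among all submodules. -/
theorem isFractional_of_mul_le {N P J : Submodule A L} (hN : N ≠ ⊥) (hP : IsFractional A⁰ P)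
    (h : N * J ≤ P) : IsFractional A⁰ J := by
  rw [isFractional_iff_exists_mul_mem_one] at hP ⊢
  obtain ⟨c, hc, hcP⟩ := hP
  obtain ⟨n, hn, hn0⟩ := N.ne_bot_iff.1 hN
  refine ⟨c * n, mul_ne_zero hc hn0, fun j hj => ?_⟩
  rw [mul_assoc]
  exact hcP _ (h (Submodule.mul_mem_mul hn hj))

theorem isCliffordRegular_iff_fractionalIdeal :
    IsCliffordRegular A ↔ ∀ I : FractionalIdeal A⁰ (FractionRing A), I ≠ 0 →
      ∃ J : FractionalIdeal A⁰ (FractionRing A), I * I * J = I := by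
  constructor
  · intro h I hI
    obtain ⟨a, ha⟩ := h (((⟨I, hI⟩ : nonzeroFractionalIdeals A)) : (principalCon A).Quotient)
    induction a using Con.induction_on with
    | H J =>
      rw [← Con.coe_mul, ← Con.coe_mul] at ha
      obtain ⟨x, hx, hxe⟩ := (Con.eq (principalCon A)).1 ha
      refine ⟨FractionalIdeal.spanSingleton A⁰ x * J, ?_⟩
      rw [mul_left_comm]
      exact hxe.symm
  · intro h s
    induction s using Con.induction_on with
    | H I =>
      obtain ⟨J, hJ⟩ := h I.1 I.2
      have hJ0 : J ≠ 0 := by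
        rintro rfl
        exact I.2 (by rw [← hJ, mul_zero])
      refine ⟨((⟨J, hJ0⟩ : nonzeroFractionalIdeals A) : (principalCon A).Quotient), ?_⟩
      rw [← Con.coe_mul, ← Con.coe_mul]
      exact congrArg _ (Subtype.ext hJ)

variable (L) in
theorem isCliffordRegular_iff_isVonNeumannRegular :
    IsCliffordRegular A ↔
      ∀ N : Submodule A L, N ≠ ⊥ → IsFractional A⁰ N → N.IsVonNeumannRegular := by
  rw [isCliffordRegular_iff_fractionalIdeal]
  let e := FractionalIdeal.canonicalEquiv A⁰ (FractionRing A) L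
  constructor
  · intro h N hN hf
    let I : FractionalIdeal A⁰ L := ⟨N, hf⟩
    have hI : I ≠ 0 := fun h0 => hN (by
      have := congrArg (fun I : FractionalIdeal A⁰ L => (I : Submodule A L)) h0
      simpa [I] using this)
    obtain ⟨J, hJ⟩ := h (e.symm I) (by simpa using hI)
    refine ⟨(e J : FractionalIdeal A⁰ L), ?_⟩
    have := congrArg e hJ
    simp only [map_mul, RingEquiv.apply_symm_apply] at this
    have := congrArg (fun I : FractionalIdeal A⁰ L => (I : Submodule A L)) this
    rwa [FractionalIdeal.coe_mul, FractionalIdeal.coe_mul] at this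
  · intro h I hI
    have hI' : ((e I : FractionalIdeal A⁰ L) : Submodule A L) ≠ ⊥ := by
      rw [Ne, FractionalIdeal.coeToSubmodule_eq_bot]
      simpa using hI
    obtain ⟨J, hJ⟩ := h (e I : FractionalIdeal A⁰ L) hI' (e I).isFractional
    have hJf : IsFractional A⁰ J :=
      isFractional_of_mul_le (Submodule.mul_ne_bot_of_field hI' hI') (e I).isFractional hJ.le
    obtain ⟨J, rfl⟩ : ∃ J' : FractionalIdeal A⁰ L, (J' : Submodule A L) = J := ⟨⟨J, hJf⟩, rfl⟩
    refine ⟨e.symm J, e.injective ?_⟩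
    rw [map_mul, map_mul, RingEquiv.apply_symm_apply]
    apply FractionalIdeal.coeToSubmodule_injective
    change ((_ : FractionalIdeal A⁰ L) : Submodule A L) = _
    rwa [FractionalIdeal.coe_mul, FractionalIdeal.coe_mul]

end FractionField

/-! ### Conducive domains -/

section Conducive

variable {K : Type*} [Field K] (D : Subring K)

/-- A nonzero nonunit `x` of `D` is a nonunit in some valuation overring `V`. Then `x⁻¹ ∉ V`, so `V
≠ K` and conduciveness applies to `V`. -/
theorem exists_valuationSubring_conductor (hD : D ≠ ⊤) [IsFractionRing D K] (hc : IsConducive D) :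
    ∃ (V : ValuationSubring K) (c : K), c ≠ 0 ∧ ∀ v ∈ V, c * v ∈ D := by
  obtain ⟨x, hx, hxD⟩ : ∃ x ∈ D, x⁻¹ ∉ D := by
    by_contra! h
    refine hD ((Subring.eq_top_iff' _).2 fun k => ?_)
    obtain ⟨a, b, -, rfl⟩ := IsFractionRing.div_surjective (A := D) k
    rw [div_eq_mul_inv]
    exact D.mul_mem a.2 (h _ b.2)
  have hx0 : x ≠ 0 := by
    rintro rfl
    exact hxD (by simp)
  have hI : Ideal.span {(⟨x, hx⟩ : D)} ≠ ⊤ := by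
    rw [Ne, Ideal.span_singleton_eq_top]
    intro hu
    obtain ⟨y, hy⟩ := hu.exists_right_inv
    have hxy : x * (y : K) = 1 := congrArg Subtype.val hy
    exact hxD (by rw [inv_eq_of_mul_eq_one_right hxy]; exact y.2)
  obtain ⟨V, hDV, hV⟩ := Ideal.image_subset_nonunits_valuationSubring _ hI
  have hxV : x⁻¹ ∉ V := by
    have h1 : x ∈ V.nonunits := hV ⟨⟨x, hx⟩, Ideal.mem_span_singleton_self _, rfl⟩
    intro h2
    rw [ValuationSubring.mem_nonunits_iff] at h1
    rw [← V.valuation_le_one_iff, map_inv₀] at h2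
    exact absurd h2 (not_le.2 ((one_lt_inv₀ (by simpa [zero_lt_iff] using hx0)).2 h1))
  let e : FractionRing D ≃ₐ[D] K := FractionRing.algEquiv D K
  let W : Subalgebra D K := { V.toSubring with algebraMap_mem' := fun r => hDV r.2 }
  let B : Subalgebra D (FractionRing D) := W.comap (e : FractionRing D →ₐ[D] K)
  have hB : B ≠ ⊤ := by
    intro h
    have : e.symm x⁻¹ ∈ B := h ▸ Algebra.mem_top
    have h3 : e (e.symm x⁻¹) ∈ V := this
    rw [AlgEquiv.apply_symm_apply] at h3
    exact hxV h3
  obtain ⟨c, hcm, hc0⟩ := (Submodule.ne_bot_iff _).1 (hc B hB)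
  refine ⟨V, e c, by simpa using hc0, fun v hv => ?_⟩
  have hvB : e.symm v ∈ Subalgebra.toSubmodule B := by
    change e (e.symm v) ∈ V
    rwa [AlgEquiv.apply_symm_apply]
  obtain ⟨d, hd⟩ := Submodule.mem_one.1 (Submodule.mem_div_iff_forall_mul_mem.1 hcm _ hvB)
  have h4 := congrArg e hd
  rw [map_mul, AlgEquiv.apply_symm_apply, AlgEquiv.commutes] at h4
  rw [← h4]
  exact d.2

/-- Over a conducive domain which is not a field, every proper submodule of the quotient field
is a fractional ideal. -/
theorem IsConducive.isFractional (hD : D ≠ ⊤) [IsFractionRing D K] (hc : IsConducive D)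
    {E : Submodule D K} (hE : E ≠ ⊤) : IsFractional D⁰ E := by
  obtain ⟨V, c, hc0, hV⟩ := exists_valuationSubring_conductor D hD hc
  obtain ⟨z, hz⟩ : ∃ z, z ∉ E := by
    by_contra! h
    exact hE ((Submodule.eq_top_iff').2 h)
  have hz0 : z ≠ 0 := by
    rintro rfl
    exact hz E.zero_mem
  -- If `z / (c n)` were in `V`, then `c` times it would be in `D` and would carry `n` to `z ∉ E`.
  -- So `c n / z ∈ V`, and a second factor `c` brings it into `D`.
  refine isFractional_iff_exists_mul_mem_one.2 ⟨c * c / z, div_ne_zero (mul_ne_zero hc0 hc0) hz0, fun n hn => ?_⟩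
  by_cases hn0 : n = 0
  · simp [hn0]
  have hcV : z / (c * n) ∉ V := by
    intro hv
    have h1 : (⟨_, hV _ hv⟩ : D) • n ∈ E := E.smul_mem _ hn
    have h2 : (⟨_, hV _ hv⟩ : D) • n = z := by
      change c * (z / (c * n)) * n = z
      field_simp
    exact hz (h2 ▸ h1)
  have h3 := (V.mem_or_inv_mem (z / (c * n))).resolve_left hcV
  refine Submodule.mem_one.2 ⟨⟨_, hV _ h3⟩, ?_⟩
  change c * (z / (c * n))⁻¹ = c * c / z * n
  rw [inv_div]
  ring

end Conducive

/-! ### Pullbacks along a surjection onto a field -/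

section Pullback

variable {K T F : Type*} [Field K] [CommRing T] [Field F] [Algebra T F]
  (D : Subring K) (φ : T →+* K)

theorem algebraMap_comap_apply (r : D.comap φ) :
    algebraMap (D.comap φ) F r = algebraMap T F r := rfl

/-- The inverse image of a submodule of `K`, as a submodule of the quotient field. -/
def pullbackSubmodule (E : Submodule D K) : Submodule (D.comap φ) F where
  carrier := {x | ∃ t : T, φ t ∈ E ∧ algebraMap T F t = x}
  zero_mem' := ⟨0, by simp, by simp⟩
  add_mem' := by
    rintro _ _ ⟨s, hs, rfl⟩ ⟨t, ht, rfl⟩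
    exact ⟨s + t, by rw [map_add]; exact E.add_mem hs ht, map_add _ _ _⟩
  smul_mem' := by
    rintro r _ ⟨t, ht, rfl⟩
    refine ⟨r * t, ?_, ?_⟩
    · rw [map_mul]
      exact E.smul_mem (⟨φ r, r.2⟩ : D) ht
    · rw [map_mul, Algebra.smul_def, algebraMap_comap_apply]

/-- The image in `K` of the part of a submodule of the quotient field which lies in `T`. -/
def pushforwardSubmodule (hφ : Function.Surjective φ) (N : Submodule (D.comap φ) F) :
    Submodule D K where
  carrier := {k | ∃ t : T, algebraMap T F t ∈ N ∧ φ t = k}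
  zero_mem' := ⟨0, by simp, by simp⟩
  add_mem' := by
    rintro _ _ ⟨s, hs, rfl⟩ ⟨t, ht, rfl⟩
    exact ⟨s + t, by rw [map_add]; exact N.add_mem hs ht, map_add _ _ _⟩
  smul_mem' := by
    rintro ⟨d, hd⟩ _ ⟨t, ht, rfl⟩
    obtain ⟨r, rfl⟩ := hφ d
    refine ⟨r * t, ?_, map_mul _ _ _⟩
    have := N.smul_mem (⟨r, hd⟩ : D.comap φ) ht
    rwa [Algebra.smul_def, algebraMap_comap_apply, ← map_mul] at this

variable {D φ}

theorem pullbackSubmodule_pushforwardSubmodule (hφ : Function.Surjective φ)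
    {N : Submodule (D.comap φ) F} (h1 : ∀ n ∈ N, ∃ t : T, algebraMap T F t = n)
    (h2 : ∀ t : T, φ t = 0 → algebraMap T F t ∈ N) :
    pullbackSubmodule D φ (pushforwardSubmodule D φ hφ N) = N := by
  refine le_antisymm ?_ fun n hn => ?_
  · rintro _ ⟨t, ⟨s, hs, hst⟩, rfl⟩
    have h3 := h2 (t - s) (by rw [map_sub, hst, sub_self])
    rw [map_sub] at h3
    simpa using N.add_mem h3 hs
  · obtain ⟨t, rfl⟩ := h1 n hn
    exact ⟨t, ⟨t, hn, rfl⟩, rfl⟩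

variable [IsFractionRing T F]

theorem algebraMap_mem_pullbackSubmodule {E : Submodule D K} {t : T} :
    algebraMap T F t ∈ pullbackSubmodule (F := F) D φ E ↔ φ t ∈ E := by
  constructor
  · rintro ⟨s, hs, h⟩
    rwa [← IsFractionRing.injective T F h]
  · exact fun h => ⟨t, h, rfl⟩

theorem pullbackSubmodule_ne_bot (hφ : Function.Surjective φ) {E : Submodule D K} (hE : E ≠ ⊥) :
    pullbackSubmodule (F := F) D φ E ≠ ⊥ := by
  obtain ⟨e, he, he0⟩ := E.ne_bot_iff.1 hE
  obtain ⟨t, rfl⟩ := hφ e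
  refine (Submodule.ne_bot_iff _).2 ⟨_, algebraMap_mem_pullbackSubmodule.2 he, ?_⟩
  rw [Ne, FaithfulSMul.algebraMap_eq_zero_iff]
  rintro rfl
  exact he0 (map_zero φ)

/-- Lifts of an element of `E * E'` differ by `ker φ`, so it suffices that the right side contains
`ker φ`. Lift a nonzero element of `E` to a unit `u` and write `t = u (u⁻¹ t)`. -/
theorem pullbackSubmodule_mul (hφ : Function.Surjective φ)
    (hu : ∀ k : K, k ≠ 0 → ∃ u : Tˣ, φ u = k)
    {E E' : Submodule D K} (hE : E ≠ ⊥) :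
    pullbackSubmodule (F := F) D φ (E * E') =
      pullbackSubmodule D φ E * pullbackSubmodule D φ E' := by
  refine le_antisymm ?_ (Submodule.mul_le.2 ?_)
  · obtain ⟨e, he, he0⟩ := E.ne_bot_iff.1 hE
    obtain ⟨u, rfl⟩ := hu e he0
    have hker : ∀ t : T, φ t = 0 →
        algebraMap T F t ∈ pullbackSubmodule (F := F) D φ E * pullbackSubmodule D φ E' := by
      intro t ht
      have h1 : algebraMap T F (↑u⁻¹ * t) ∈ pullbackSubmodule (F := F) D φ E' :=
        algebraMap_mem_pullbackSubmodule.2 (by simp [ht])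
      have h2 := Submodule.mul_mem_mul (algebraMap_mem_pullbackSubmodule (F := F).2 he) h1
      rwa [← map_mul, Units.mul_inv_cancel_left] at h2
    rintro _ ⟨t, ht, rfl⟩
    suffices ∀ k ∈ E * E', ∀ t : T, φ t = k →
        algebraMap T F t ∈ pullbackSubmodule (F := F) D φ E * pullbackSubmodule D φ E' from
      this _ ht _ rfl
    intro k hk
    induction hk using Submodule.mul_induction_on' with
    | mem_mul_mem a ha b hb =>
      intro t ht
      obtain ⟨a, rfl⟩ := hφ a
      obtain ⟨b, rfl⟩ := hφ b
      have h1 := hker (t - a * b) (by simp [ht])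
      have h2 := Submodule.mul_mem_mul (algebraMap_mem_pullbackSubmodule (F := F).2 ha)
        (algebraMap_mem_pullbackSubmodule (F := F).2 hb)
      simpa using Submodule.add_mem _ h1 h2
    | add x _ y _ hx hy =>
      intro t ht
      obtain ⟨s, hs⟩ := hφ x
      have := Submodule.add_mem _ (hx s hs) (hy (t - s) (by simp [ht, hs]))
      simpa using this
  · rintro _ ⟨s, hs, rfl⟩ _ ⟨t, ht, rfl⟩
    exact ⟨s * t, by rw [map_mul]; exact Submodule.mul_mem_mul hs ht, map_mul _ _ _⟩

theorem isVonNeumannRegular_pullbackSubmodule (hD : D ≠ ⊤) [IsFractionRing D K]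
    (hc : IsConducive D) (hu : ∀ k : K, k ≠ 0 → ∃ u : Tˣ, φ u = k)
    (hφ : Function.Surjective φ) (h : IsCliffordRegular D)
    {E : Submodule D K} (hE : E ≠ ⊥) :
    (pullbackSubmodule (F := F) D φ E).IsVonNeumannRegular := by
  obtain ⟨J, hJ⟩ : E.IsVonNeumannRegular := by
    by_cases ht : E = ⊤
    · subst ht
      refine ⟨⊤, top_le_iff.1 fun x _ => ?_⟩
      simpa using Submodule.mul_mem_mul (Submodule.mul_mem_mul
        (Submodule.mem_top : (1 : K) ∈ (⊤ : Submodule D K))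
        (Submodule.mem_top : (1 : K) ∈ (⊤ : Submodule D K)))
        (Submodule.mem_top : x ∈ (⊤ : Submodule D K))
    · exact (isCliffordRegular_iff_isVonNeumannRegular K).1 h E hE (hc.isFractional D hD ht)
  refine ⟨pullbackSubmodule D φ J, ?_⟩
  rw [← pullbackSubmodule_mul hφ hu hE,
    ← pullbackSubmodule_mul hφ hu (Submodule.mul_ne_bot_of_field hE hE), hJ]

theorem isVonNeumannRegular_of_le_of_ker_le (hD : D ≠ ⊤) [IsFractionRing D K]
    (hc : IsConducive D) (hu : ∀ k : K, k ≠ 0 → ∃ u : Tˣ, φ u = k)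
    (hφ : Function.Surjective φ) (h : IsCliffordRegular D)
    {N : Submodule (D.comap φ) F} (h1 : ∀ n ∈ N, ∃ t : T, algebraMap T F t = n)
    (h2 : ∀ t : T, φ t = 0 → algebraMap T F t ∈ N)
    (h3 : ∃ t : T, algebraMap T F t ∈ N ∧ φ t ≠ 0) : N.IsVonNeumannRegular := by
  rw [← pullbackSubmodule_pushforwardSubmodule hφ h1 h2]
  obtain ⟨t, ht, ht0⟩ := h3
  exact isVonNeumannRegular_pullbackSubmodule hD hc hu hφ h
    ((Submodule.ne_bot_iff _).2 ⟨φ t, ⟨t, ht, rfl⟩, ht0⟩)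

variable [IsDomain T]

-- A denominator of `φ t` in `D` lifts to a nonzero `s` with `s` and `s t` both in the pullback.
variable (F) in
theorem isFractionRing_comap [IsFractionRing D K] (hφ : Function.Surjective φ) :
    IsFractionRing (D.comap φ) F := by
  have key : ∀ t : T, ∃ r s : T, r ∈ D.comap φ ∧ s ∈ D.comap φ ∧ s ≠ 0 ∧ s * t = r := by
    intro t
    obtain ⟨a, b, hb, hab⟩ := IsFractionRing.div_surjective (A := D) (φ t)
    have hb0 : (b : K) ≠ 0 := IsFractionRing.to_map_ne_zero_of_mem_nonZeroDivisors (K := K) hb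
    obtain ⟨s, hs⟩ := hφ b
    refine ⟨s * t, s, ?_, ?_, ?_, rfl⟩
    · rw [Subring.mem_comap, map_mul, ← hab, hs]
      have : (b : K) * (algebraMap D K a / algebraMap D K b) = a := mul_div_cancel₀ _ hb0
      rw [this]
      exact a.2
    · rw [Subring.mem_comap, hs]
      exact b.2
    · rintro rfl
      exact hb0 (by rw [← hs, map_zero])
  have : FaithfulSMul (D.comap φ) F := by
    rw [faithfulSMul_iff_algebraMap_injective]
    exact fun a b h => Subtype.ext (IsFractionRing.injective T F h)
  refine IsFractionRing.of_field (D.comap φ) F fun z => ?_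
  obtain ⟨x, y, hy, rfl⟩ := IsFractionRing.div_surjective (A := T) z
  obtain ⟨r, s, hr, hs, hs0, h1⟩ := key x
  obtain ⟨r', s', hr', hs', hs0', h2⟩ := key y
  refine ⟨⟨r * s', (D.comap φ).mul_mem hr hs'⟩, ⟨r' * s, (D.comap φ).mul_mem hr' hs⟩, ?_⟩
  rw [algebraMap_comap_apply, algebraMap_comap_apply]
  change _ = algebraMap T F (r * s') / algebraMap T F (r' * s)
  rw [← h1, ← h2]
  have h3 : algebraMap T F s ≠ 0 := by simpa using hs0
  have h4 : algebraMap T F s' ≠ 0 := by simpa using hs0'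
  have h5 : algebraMap T F y ≠ 0 := IsFractionRing.to_map_ne_zero_of_mem_nonZeroDivisors hy
  simp only [map_mul]
  field_simp

variable (F) in
include F in
theorem IsCliffordRegular.of_comap [IsFractionRing D K]
    (hu : ∀ k : K, k ≠ 0 → ∃ u : Tˣ, φ u = k) (hφ : Function.Surjective φ)
    (h : IsCliffordRegular (D.comap φ)) : IsCliffordRegular D := by
  have := isFractionRing_comap (D := D) F hφ
  rw [isCliffordRegular_iff_isVonNeumannRegular F] at h
  rw [isCliffordRegular_iff_isVonNeumannRegular K]
  intro E hE hf
  have hf' : IsFractional (D.comap φ)⁰ (pullbackSubmodule (F := F) D φ E) := by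
    obtain ⟨d, hd, hdE⟩ := hf
    obtain ⟨s, hs⟩ := hφ d
    have hs0 : s ≠ 0 := by
      rintro rfl
      rw [map_zero] at hs
      exact nonZeroDivisors.ne_zero hd (Subtype.ext hs.symm)
    refine isFractional_iff_exists_mul_mem_one.2 ⟨algebraMap T F s, by simpa using hs0, ?_⟩
    rintro _ ⟨t, ht, rfl⟩
    obtain ⟨a, ha⟩ := hdE _ ht
    refine Submodule.mem_one.2 ⟨⟨s * t, ?_⟩, map_mul (algebraMap T F) s t⟩
    rw [Subring.mem_comap, map_mul, hs]
    have : (a : K) = d * φ t := ha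
    rw [← this]
    exact a.2
  obtain ⟨J, hJ⟩ := h _ (pullbackSubmodule_ne_bot hφ hE) hf'
  -- A unit `u` in the pullback of `E` gives `u² J ⊆ T`, so `J ⊆ T` and nothing is lost in pushing
  -- `J` forward.
  have hJT : ∀ j ∈ J, ∃ t : T, algebraMap T F t = j := by
    intro j hj
    obtain ⟨e, he, he0⟩ := E.ne_bot_iff.1 hE
    obtain ⟨u, rfl⟩ := hu e he0
    have h1 := algebraMap_mem_pullbackSubmodule (F := F).2 he
    have h2 := Submodule.mul_mem_mul (Submodule.mul_mem_mul h1 h1) hj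
    rw [hJ] at h2
    obtain ⟨t, -, ht⟩ := h2
    refine ⟨↑u⁻¹ * ↑u⁻¹ * t, ?_⟩
    rw [map_mul, ht, ← map_mul, ← mul_assoc, ← map_mul]
    simp [mul_assoc]
  refine ⟨pushforwardSubmodule D φ hφ J, le_antisymm ?_ ?_⟩
  · rw [mul_assoc]
    refine Submodule.mul_le.2 fun a ha x hx => ?_
    induction hx using Submodule.mul_induction_on' with
    | mem_mul_mem b hb c hc =>
      obtain ⟨t, ht, rfl⟩ := hc
      obtain ⟨a, rfl⟩ := hφ a
      obtain ⟨b, rfl⟩ := hφ b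
      rw [← map_mul, ← map_mul, ← algebraMap_mem_pullbackSubmodule (F := F), ← hJ, ← mul_assoc,
        map_mul, map_mul]
      exact Submodule.mul_mem_mul (Submodule.mul_mem_mul (algebraMap_mem_pullbackSubmodule.2 ha)
        (algebraMap_mem_pullbackSubmodule.2 hb)) ht
    | add x _ y _ hx hy => rw [mul_add]; exact E.add_mem hx hy
  · have hle : pullbackSubmodule (F := F) D φ E ≤
        pullbackSubmodule D φ (E * E * pushforwardSubmodule D φ hφ J) := by
      rw [pullbackSubmodule_mul hφ hu (Submodule.mul_ne_bot_of_field hE hE),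
        pullbackSubmodule_mul hφ hu hE]
      conv_lhs => rw [← hJ]
      refine mul_le_mul_right (fun j hj => ?_) _
      obtain ⟨t, rfl⟩ := hJT j hj
      exact ⟨t, ⟨t, hj, rfl⟩, rfl⟩
    intro e he
    obtain ⟨t, rfl⟩ := hφ e
    exact algebraMap_mem_pullbackSubmodule.1 (hle (algebraMap_mem_pullbackSubmodule (F := F).2 he))

end Pullback

/-! ### Ascent when `T` is a principal ideal ring -/

section Principal

variable {K T : Type*} (F : Type*) [Field K] [CommRing T] [IsDomain T] [IsPrincipalIdealRing T]
  [Field F] [Algebra T F] [IsFractionRing T F] {D : Subring K} {φ : T →+* K}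

include F in
theorem IsCliffordRegular.comap_of_isPrincipalIdealRing (hD : D ≠ ⊤) [IsFractionRing D K]
    (hc : IsConducive D) (hu : ∀ k : K, k ≠ 0 → ∃ u : Tˣ, φ u = k)
    (hφ : Function.Surjective φ) (h : IsCliffordRegular D) : IsCliffordRegular (D.comap φ) := by
  have := isFractionRing_comap (D := D) F hφ
  rw [isCliffordRegular_iff_isVonNeumannRegular F]
  intro N hN hf
  obtain ⟨c, hc0, hcN⟩ := isFractional_iff_exists_mul_mem_one.1 hf
  let I : Ideal T := Ideal.span {t | ∃ n ∈ N, algebraMap T F t = c * n}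
  have hNI : ∀ n ∈ N, ∃ t ∈ I, algebraMap T F t = c * n := by
    intro n hn
    obtain ⟨r, hr⟩ := Submodule.mem_one.1 (hcN n hn)
    exact ⟨r, Ideal.subset_span ⟨n, hn, hr⟩, hr⟩
  obtain ⟨f, hf⟩ : ∃ f : T, I = Ideal.span {f} := (IsPrincipalIdealRing.principal I).principal
  have hf0 : algebraMap T F f ≠ 0 := by
    rw [Ne, FaithfulSMul.algebraMap_eq_zero_iff]
    rintro rfl
    obtain ⟨n, hn, hn0⟩ := N.ne_bot_iff.1 hN
    obtain ⟨t, ht, htn⟩ := hNI n hn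
    rw [hf, Ideal.mem_span_singleton, zero_dvd_iff] at ht
    rw [ht, map_zero] at htn
    exact mul_ne_zero hc0 hn0 htn.symm
  -- `ker φ` is an ideal of `T` contained in the pullback, so multiplying by it absorbs the
  -- `T`-coefficients: `ker φ · I ⊆ c N`.
  have hker : ∀ a ∈ I, ∀ m : T, φ m = 0 → ∃ n ∈ N, algebraMap T F (m * a) = c * n := by
    intro a ha
    induction ha using Submodule.span_induction with
    | mem a ha =>
      intro m hm
      obtain ⟨n, hn, han⟩ := ha
      refine ⟨_, N.smul_mem (⟨m, by simp [hm]⟩ : D.comap φ) hn, ?_⟩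
      rw [Algebra.smul_def, algebraMap_comap_apply, map_mul, han]
      ring
    | zero => exact fun m _ => ⟨0, N.zero_mem, by simp⟩
    | add a b _ _ iha ihb =>
      intro m hm
      obtain ⟨x, hx, hax⟩ := iha m hm
      obtain ⟨y, hy, hby⟩ := ihb m hm
      exact ⟨x + y, N.add_mem hx hy, by rw [mul_add, map_add, hax, hby, mul_add]⟩
    | smul t a _ iha =>
      intro m hm
      obtain ⟨x, hx, hax⟩ := iha (m * t) (by simp [hm])
      exact ⟨x, hx, by rw [smul_eq_mul, ← mul_assoc, hax]⟩
  -- After this scaling `N` generates the unit ideal of `T`.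
  have hx0 : c / algebraMap T F f ≠ 0 := div_ne_zero hc0 hf0
  refine Submodule.IsVonNeumannRegular.of_span_singleton_mul hx0
    (isVonNeumannRegular_of_le_of_ker_le hD hc hu hφ h ?_ ?_ ?_)
  · intro x hx
    obtain ⟨n, hn, rfl⟩ := Submodule.mem_span_singleton_mul.1 hx
    obtain ⟨t, ht, htn⟩ := hNI n hn
    rw [hf, Ideal.mem_span_singleton] at ht
    obtain ⟨s, rfl⟩ := ht
    refine ⟨s, ?_⟩
    rw [div_mul_eq_mul_div, ← htn, map_mul]
    field_simp
  · intro t ht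
    obtain ⟨n, hn, htn⟩ := hker f (hf ▸ Ideal.mem_span_singleton_self f) t ht
    refine Submodule.mem_span_singleton_mul.2 ⟨n, hn, ?_⟩
    rw [div_mul_eq_mul_div, ← htn, map_mul]
    field_simp
  -- A zero image would give `(f) ⊆ f · ker φ`, hence `1 ∈ ker φ`.
  · by_contra! hcon
    have hle : I ≤ Ideal.span {f} * RingHom.ker φ := by
      refine Ideal.span_le.2 ?_
      rintro a ⟨n, hn, han⟩
      obtain ⟨t, ht, htn⟩ := hNI n hn
      have hat : a = t := IsFractionRing.injective T F (han.trans htn.symm)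
      rw [hf, Ideal.mem_span_singleton] at ht
      obtain ⟨s, rfl⟩ := ht
      rw [hat]
      refine Ideal.mul_mem_mul (Ideal.mem_span_singleton_self f) (hcon s ?_)
      refine Submodule.mem_span_singleton_mul.2 ⟨n, hn, ?_⟩
      rw [div_mul_eq_mul_div, ← htn, map_mul]
      field_simp
    have hfm := hle (hf ▸ Ideal.mem_span_singleton_self f)
    obtain ⟨s, hs, hsf⟩ := Ideal.mem_span_singleton_mul.1 hfm
    have hs1 : s = 1 := mul_left_cancel₀ (a := f) (fun h0 => hf0 (by rw [h0, map_zero]))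
      (by rw [hsf, mul_one])
    rw [hs1, RingHom.mem_ker, map_one] at hs
    exact one_ne_zero hs

end Principal

theorem IsLocalRing.isUnit_of_surjective_of_ne_zero {K T : Type*} [Field K] [CommRing T]
    [IsLocalRing T] {φ : T →+* K} (hφ : Function.Surjective φ) {t : T}
    (ht : φ t ≠ 0) : IsUnit t := by
  by_contra h
  have := RingHom.ker_isMaximal_of_surjective φ hφ
  rw [← mem_nonunits_iff, ← IsLocalRing.mem_maximalIdeal, ← IsLocalRing.eq_maximalIdeal this] at h
  exact ht h

/-! ### Ascent when `T` is a valuation ring -/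

section Valuation

variable {K T F : Type*} [Field K] [CommRing T] [IsDomain T] [ValuationRing T]
  [Field F] [Algebra T F] [IsFractionRing T F] {D : Subring K} {φ : T →+* K}

/-- The ideals of a valuation domain are von Neumann regular, also when viewed as modules over
a subring. -/
theorem isVonNeumannRegular_of_algebraMap_mul_mem {R : Subring T} {N : Submodule R F}
    (hN : ∀ n ∈ N, ∀ t : T, algebraMap T F t * n ∈ N) : N.IsVonNeumannRegular := by
  refine ⟨N / (N * N), le_antisymm ?_ fun a ha => ?_⟩
  · rw [mul_comm]
    exact Submodule.mul_le.2 fun x hx y hy => Submodule.mem_div_iff_forall_mul_mem.1 hx y hy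
  have hdiv : ∀ x : F, (∀ y ∈ N, ∀ z ∈ N, x * (y * z) ∈ N) → x ∈ N / (N * N) := by
    intro x hx
    refine Submodule.mem_div_iff_forall_mul_mem.2 fun w hw => ?_
    induction hw using Submodule.mul_induction_on' with
    | mem_mul_mem y hy z hz => exact hx y hy z hz
    | add y _ z _ hy hz => rw [mul_add]; exact N.add_mem hy hz
  by_cases ha0 : a = 0
  · subst ha0
    exact Submodule.zero_mem _
  by_cases hcase : ∀ y ∈ N, ∀ z ∈ N, a⁻¹ * (y * z) ∈ N
  · have := Submodule.mul_mem_mul (Submodule.mul_mem_mul ha ha) (hdiv _ hcase)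
    rwa [mul_assoc a, mul_inv_cancel₀ ha0, mul_one] at this
  -- Now `b x / a ∉ N` with `b, x ∈ N`. For nonzero `y ∈ N`, `b x / (a y) ∈ T` would force `b x / a
  -- ∈ N`; hence `a y / (b x) ∈ T`, and `a / (b x)` lies in the quotient.
  · push Not at hcase
    obtain ⟨b, hb, x, hx, hbx⟩ := hcase
    have hb0 : b ≠ 0 := by rintro rfl; simp at hbx
    have hx0 : x ≠ 0 := by rintro rfl; simp at hbx
    have hj : a / (b * x) ∈ N / (N * N) := by
      refine hdiv _ fun y hy z hz => ?_
      by_cases hy0 : y = 0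
      · simp [hy0]
      have hyT : ∃ t : T, algebraMap T F t = a / (b * x) * y := by
        rcases ValuationRing.isInteger_or_isInteger T (a / (b * x) * y) with ⟨t, ht⟩ | ⟨t, ht⟩
        · exact ⟨t, ht⟩
        · refine absurd ?_ hbx
          have := hN y hy t
          rw [ht] at this
          convert this using 1
          field_simp
      obtain ⟨t, ht⟩ := hyT
      rw [← mul_assoc, ← ht]
      exact hN z hz t
    have := Submodule.mul_mem_mul (Submodule.mul_mem_mul hb hx) hj
    rwa [mul_div_cancel₀ _ (mul_ne_zero hb0 hx0)] at this

variable (F) in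
include F in
theorem IsCliffordRegular.comap_of_valuationRing (hD : D ≠ ⊤) [IsFractionRing D K]
    (hc : IsConducive D) (hu : ∀ k : K, k ≠ 0 → ∃ u : Tˣ, φ u = k)
    (hφ : Function.Surjective φ) (h : IsCliffordRegular D) : IsCliffordRegular (D.comap φ) := by
  have := isFractionRing_comap (D := D) F hφ
  rw [isCliffordRegular_iff_isVonNeumannRegular F]
  intro N hN _
  by_cases hcase : ∃ b ∈ N, b ≠ 0 ∧ ∀ n ∈ N, ∃ t : T, algebraMap T F t = b⁻¹ * n
  · obtain ⟨b, hb, hb0, hbN⟩ := hcase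
    have h1 : (1 : F) ∈ Submodule.span (D.comap φ) {b⁻¹} * N :=
      Submodule.mem_span_singleton_mul.2 ⟨b, hb, inv_mul_cancel₀ hb0⟩
    refine Submodule.IsVonNeumannRegular.of_span_singleton_mul (inv_ne_zero hb0)
      (isVonNeumannRegular_of_le_of_ker_le hD hc hu hφ h ?_ ?_ ?_)
    · intro x hx
      obtain ⟨n, hn, rfl⟩ := Submodule.mem_span_singleton_mul.1 hx
      exact hbN n hn
    · intro t ht
      have := Submodule.smul_mem _ (⟨t, by simp [ht]⟩ : D.comap φ) h1
      rwa [Algebra.smul_def, algebraMap_comap_apply, mul_one] at this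
    · exact ⟨1, by rwa [map_one], by simp⟩
  -- Each nonzero `b ∈ N` has some `a ∈ N` with `a / b ∉ T`, so `b / a` is a nonunit of `T` and lies
  -- in `ker φ`. Then `t (b / a)` is in the pullback, and `t b = t (b / a) a ∈ N`: `N` is a
  -- `T`-module.
  · push Not at hcase
    refine isVonNeumannRegular_of_algebraMap_mul_mem fun b hb t => ?_
    by_cases hb0 : b = 0
    · simp [hb0]
    obtain ⟨a, ha, hab⟩ := hcase b hb hb0
    have ha0 : a ≠ 0 := by
      rintro rfl
      exact hab 0 (by simp)
    obtain ⟨s, hs⟩ : ∃ s : T, algebraMap T F s = a⁻¹ * b := by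
      rcases ValuationRing.isInteger_or_isInteger T (b⁻¹ * a) with ⟨t, ht⟩ | ⟨t, ht⟩
      · exact absurd ht (hab t)
      · exact ⟨t, by rw [ht, mul_inv, inv_inv, mul_comm]⟩
    have hs0 : φ s = 0 := by
      by_contra hne
      obtain ⟨u, rfl⟩ := IsLocalRing.isUnit_of_surjective_of_ne_zero hφ hne
      refine hab (↑u⁻¹) ?_
      have h2 : algebraMap T F ↑u⁻¹ * algebraMap T F u = 1 := by rw [← map_mul]; simp
      rw [eq_inv_of_mul_eq_one_left h2, hs, mul_inv, inv_inv, mul_comm]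
    have := N.smul_mem (⟨t * s, by simp [hs0]⟩ : D.comap φ) ha
    rw [Algebra.smul_def, algebraMap_comap_apply, map_mul, hs] at this
    convert this using 1
    field_simp

end Valuation

end

theorem theorem5p5 {K : Type*} [Field K] (D : Subring K) (hD : D ≠ ⊤)
    (hk : IsFractionRing D K) (hsl : HasFinitelyManyMaximalIdeals D) (hc : IsConducive D) :
    (∀ {T : Type*} [CommRing T] [IsDomain T] [ValuationRing T] (φ : T →+* K),
      Function.Surjective φ →
        (IsCliffordRegular (D.comap φ) ↔ IsCliffordRegular D)) ∧
    (IsCliffordRegular (dPlusXK D) ↔ IsCliffordRegular D) := by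
  constructor
  · intro T _ _ _ φ hφ
    have hu : ∀ k : K, k ≠ 0 → ∃ u : Tˣ, φ u = k := by
      intro k hk0
      obtain ⟨t, rfl⟩ := hφ k
      obtain ⟨u, rfl⟩ := IsLocalRing.isUnit_of_surjective_of_ne_zero hφ hk0
      exact ⟨u, rfl⟩
    exact ⟨.of_comap (FractionRing T) hu hφ, .comap_of_valuationRing (FractionRing T) hD hc hu hφ⟩
  · rw [dPlusXK_eq_comap]
    have hφ : Function.Surjective (Polynomial.constantCoeff : K[X] →+* K) :=
      Polynomial.constantCoeff_surjective
    have hu : ∀ k : K, k ≠ 0 → ∃ u : K[X]ˣ, (Polynomial.constantCoeff : K[X] →+* K) u = k :=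
      fun k hk0 => ⟨Units.map (Polynomial.C : K →+* K[X]).toMonoidHom (Units.mk0 k hk0), by simp⟩
    exact ⟨.of_comap (FractionRing K[X]) hu hφ,
      .comap_of_isPrincipalIdealRing (FractionRing K[X]) hD hc hu hφ⟩
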